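/- Let $n\ge 0$, $V=\{1,\dots,n\}$, and let $P_n$ be the path $1-2-\cdots-n$. All random variables are discrete with finite entropy. Random variables $X_1,\dots,X_n$ form a Markov chain $X_1\to\cdots\to X_n$ if for every partition $\{U,V_1,V_2\}$ of $V$ such that $V_1$ and $V_2$ are disconnected in $P_n\setminus U$, the tuples $X_{V_1}$ and $X_{V_2}$ are independent conditioning on $X_U$, where $X_B=(X_i,\,i\in B)$. With set variables $\tilde X_i$, $i\in V$, and $\tilde X_B=\bigcup_{i\in B}\tilde X_i$, let $\mu^*$ be the $I$-Measure of $X_1,\dots,X_n$, i.e. the unique signed measure on the field generated by $\tilde X_1,\dots,\tilde X_n$ (with universal set $\tilde X_V$) such that $\mu^*\big((\tilde X_A\cap\tilde X_B)\setminus\tilde X_C\big)=I(X_A;X_B\mid X_C)$ for all $A,B,C\subseteq V$. For a nonempty atom $A$ of this field let $U_A\subsetneq V$ be the set of indices with $A=\bigcap_{i\notin U_A}\tilde X_i\setminus\tilde X_{U_A}$. Let $\mathcal T_I$ be the set of Type I atoms, i.e. of those nonempty atoms $A$ for which $P_n\setminus U_A$ is connected. **Theorem.** 1. For every family of real numbers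 $(c_A)_{A\in\mathcal T_I}$, the inequality $$\sum_{A\in\mathcal T_I}c_A\,\mu^*(A)\ge 0$$ holds for all Markov chains $X_1\to\cdots\to X_n$ if and only if $c_A\ge 0$ for all $A\in\mathcal T_I$. 2. Consequently, there are no non-Shannon-type inequalities for Markov chains: whenever a linear information inequality $\sum_{B\subseteq V}b_B\,H(X_B)\ge 0$ with real coefficients $b_B$ holds for all Markov chains $X_1\to\cdots\to X_n$, it is implied by the nonnegativity of Shannon's information measures under the Markov constraints. That is, write $I_h(A;B\mid C)=h(A\cup C)+h(B\cup C)-h(A\cup B\cup C)-h(C)$ for a function $h:2^V\to\mathbb R$. Then $\sum_{B\subseteq V}b_B\,h(B)\ge 0$ for every $h$ with $h(\emptyset)=0$ such that $I_h(A;B\mid C)\ge 0$ for all $A,B,C\subseteq V$, and $I_h(V_1;V_2\mid U)=0$ for every partition $\{U,V_1,V_2\}$ of $V$ with $V_1$ and $V_2$ disconnected in $P_n\setminus U$. -/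

import Mathlib

open MeasureTheory
open scoped ENNReal

universe u v

namespace MarkovInfo

section SetVariables

variable {V : Type*} [Fintype V] [DecidableEq V]

/-- The nonempty atoms of the field generated by set variables `X̃ i`, `i ∈ V`.  The atom
`(⋂ i ∈ W, X̃ i) ∩ (⋂ i ∉ W, (X̃ i)ᶜ)` is encoded by the nonempty set `W` of the indices of its
uncomplemented set variables.  The atoms also serve as the points of the universal set. -/
def Atom (V : Type*) : Type _ := {W : Finset V // W.Nonempty}

instance : Fintype (Atom V) := inferInstanceAs (Fintype {W : Finset V // W.Nonempty})

/-- The set of the indices of the set variables of `A` that are not complemented. -/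
def Atom.support {V : Type*} (A : Atom V) : Finset V := A.1

/-- The set `U_A` of the indices of the set variables of `A` that are complemented. -/
def Atom.compl (A : Atom V) : Finset V := A.supportᶜ

/-- The set variable `X̃ i`, a subset of the universal set. -/
def setVar {V : Type*} (i : V) : Set (Atom V) := {A | i ∈ A.support}

/-- `X̃_B`, the union of the `X̃ i` with `i ∈ B`. -/
def setVarUnion {V : Type*} (B : Finset V) : Set (Atom V) := ⋃ i ∈ B, setVar i

/-- The field generated by the set variables. -/
instance {V : Type*} : MeasurableSpace (Atom V) :=
  MeasurableSpace.generateFrom (Set.range setVar)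

/-- The atom `(⋂ i ∉ U_A, X̃ i) \ X̃_{U_A}` as a subset of the universal set. -/
def Atom.toSet (A : Atom V) : Set (Atom V) :=
  (⋂ i ∈ A.support, setVar i) \ setVarUnion A.compl

theorem Atom.toSet_eq (A : Atom V) : A.toSet = {A} := by
  ext B
  simp only [Atom.toSet, setVarUnion, setVar, Atom.compl, Set.mem_sdiff, Set.mem_iInter,
    Set.mem_ofPred_eq, Set.mem_iUnion, Finset.mem_compl, Set.mem_singleton_iff, not_exists,
    exists_prop, not_and]
  constructor
  · rintro ⟨h1, h2⟩
    apply Subtype.ext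
    apply Finset.Subset.antisymm
    · intro i hi
      by_contra hA
      exact h2 i hA hi
    · exact h1
  · rintro rfl
    exact ⟨fun i hi => hi, fun i hi => hi⟩

theorem measurableSet_setVar {V : Type*} (i : V) : MeasurableSet (setVar i) :=
  MeasurableSpace.measurableSet_generateFrom ⟨i, rfl⟩

theorem measurableSet_setVarUnion {V : Type*} (B : Finset V) : MeasurableSet (setVarUnion B) :=
  Finset.measurableSet_biUnion B fun i _ => measurableSet_setVar i

instance : MeasurableSingletonClass (Atom V) where
  measurableSet_singleton A := by
    rw [← Atom.toSet_eq]
    exact MeasurableSet.diff (Finset.measurableSet_biInter _ fun i _ => measurableSet_setVar i)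
      (measurableSet_setVarUnion _)

/-- The value `H(X_{A ∪ C}) + H(X_{B ∪ C}) - H(X_{A ∪ B ∪ C}) - H(X_C)` of Shannon's information
measure `I(X_A ; X_B | X_C)`, where `h D` stands for `H(X_D)`.  With `B = A` this is the
conditional entropy `H(X_A | X_C)`, and with `C = ∅` it is the unconditional version. -/
def infoMeasure (h : Finset V → ℝ) (A B C : Finset V) : ℝ :=
  h (A ∪ C) + h (B ∪ C) - h (A ∪ B ∪ C) - h C

/-- The value of the `I`-Measure on the atom `A`, as a linear combination of joint entropies. -/
def atomValue (h : Finset V → ℝ) (A : Atom V) : ℝ :=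
  ∑ T ∈ A.support.powerset, (-1) ^ (T.card + 1) * h (T ∪ A.compl)

/-- The `I`-Measure with joint entropies `h`: the unique signed measure on the field generated by
the set variables that agrees with all Shannon's information measures
(`iMeasure_eq_infoMeasure`, `eq_iMeasure`). -/
noncomputable def iMeasure (h : Finset V → ℝ) : SignedMeasure (Atom V) :=
  ∑ A : Atom V, VectorMeasure.dirac A (atomValue h A)

open scoped Classical in
theorem iMeasure_apply (h : Finset V → ℝ) (E : Set (Atom V)) :
    iMeasure h E = ∑ A : Atom V, if A ∈ E then atomValue h A else 0 := by
  have hE : MeasurableSet E := E.toFinite.measurableSet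
  have hs : iMeasure h E = ∑ A : Atom V, VectorMeasure.dirac A (atomValue h A) E := by
    rw [iMeasure, ← FunLike.coeAddMonoidHom_apply, map_sum, Finset.sum_apply]
    rfl
  rw [hs]
  refine Finset.sum_congr rfl fun A _ => ?_
  split_ifs with hA
  · exact VectorMeasure.dirac_apply_of_mem hE hA
  · exact VectorMeasure.dirac_apply_of_notMem hA

theorem sum_powerset_moebius {V : Type*} [DecidableEq V] (W : Finset V) (k : Finset V → ℝ) :
    ∑ S ∈ W.powerset, ∑ T ∈ S.powerset, (-1) ^ T.card * k (S \ T) = k W := by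
  induction W using Finset.induction_on generalizing k with
  | empty => simp
  | insert a W ha ih =>
    rw [Finset.sum_powerset_insert ha, ← Finset.sum_add_distrib, ← ih fun S => k (insert a S)]
    refine Finset.sum_congr rfl fun S hS => ?_
    have haS : a ∉ S := fun h => ha (Finset.mem_powerset.1 hS h)
    rw [Finset.sum_powerset_insert haS, add_comm, add_assoc, ← Finset.sum_add_distrib]
    have : ∑ T ∈ S.powerset, ((-1 : ℝ) ^ (insert a T).card * k (insert a S \ insert a T)
        + (-1) ^ T.card * k (S \ T)) = 0 := by
      refine Finset.sum_eq_zero fun T hT => ?_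
      have haT : a ∉ T := fun h => haS (Finset.mem_powerset.1 hT h)
      rw [Finset.card_insert_of_notMem haT, Finset.insert_sdiff_insert,
        Finset.sdiff_insert_of_notMem haS, pow_succ]
      ring
    rw [this, add_zero]
    refine Finset.sum_congr rfl fun T hT => ?_
    have haT : a ∉ T := fun h => haS (Finset.mem_powerset.1 hT h)
    rw [Finset.insert_sdiff_of_notMem _ haT]

theorem sum_atoms_eq {V : Type*} [Fintype V] (f : Finset V → ℝ) (hf : f ∅ = 0) :
    ∑ A : Atom V, f A.support = ∑ S : Finset V, f S := by
  classical
  have h1 : ∑ A : Atom V, f A.support = ∑ S : Finset V with S.Nonempty, f S := by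
    refine Finset.sum_bij (fun A _ => A.support) (fun A _ => ?_)
      (fun A _ B _ h => Subtype.ext h) (fun S hS => ?_) fun _ _ => rfl
    · exact Finset.mem_filter.2 ⟨Finset.mem_univ _, A.2⟩
    · exact ⟨⟨S, (Finset.mem_filter.1 hS).2⟩, Finset.mem_univ _, rfl⟩
  rw [h1, Finset.sum_filter]
  refine Finset.sum_congr rfl fun S _ => ?_
  split_ifs with h
  · rfl
  · rw [Finset.not_nonempty_iff_eq_empty.1 h, hf]

open scoped Classical in
theorem sum_atomValue_subset (h : Finset V → ℝ) (W : Finset V) :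
    (∑ A : Atom V, if A.support ⊆ W then atomValue h A else 0) = h Finset.univ - h Wᶜ := by
  set f : Finset V → ℝ := fun S => if S ⊆ W then
    ∑ T ∈ S.powerset, (-1) ^ T.card * h (S \ T)ᶜ else 0 with hf
  have key : ∀ A : Atom V, (if A.support ⊆ W then atomValue h A else 0)
      = -(f A.support - if A.support = ∅ then h Finset.univ else 0) := by
    intro A
    have hA : A.support ≠ ∅ := Finset.nonempty_iff_ne_empty.1 A.2
    rw [if_neg hA, sub_zero, hf]
    dsimp only
    split_ifs
    · rw [atomValue, ← Finset.sum_neg_distrib]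
      refine Finset.sum_congr rfl fun T _ => ?_
      have : (A.support \ T)ᶜ = T ∪ A.compl := by
        ext i
        simp only [Atom.compl, Finset.mem_compl, Finset.mem_sdiff, Finset.mem_union]
        tauto
      rw [this, pow_succ]
      ring
    · simp
  rw [Finset.sum_congr rfl fun A _ => key A, Finset.sum_neg_distrib,
    sum_atoms_eq (fun S => f S - if S = ∅ then h Finset.univ else 0) (by simp [hf]),
    Finset.sum_sub_distrib, Finset.sum_ite_eq' Finset.univ (∅ : Finset V)]
  have h2 : ∑ S : Finset V, f S = h Wᶜ := by
    rw [← sum_powerset_moebius W fun S => h Sᶜ, hf, ← Finset.sum_filter]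
    refine Finset.sum_congr ?_ fun _ _ => rfl
    ext S
    simp
  rw [h2]
  simp

theorem mem_setVarUnion {V : Type*} (B : Finset V) (A : Atom V) :
    A ∈ setVarUnion B ↔ ∃ i ∈ B, i ∈ A.support := by
  simp [setVarUnion, setVar]

theorem iMeasure_setVarUnion (h : Finset V → ℝ) (B : Finset V) :
    iMeasure h (setVarUnion B) = h B - h ∅ := by
  classical
  have h1 := sum_atomValue_subset h Finset.univ
  have h2 := sum_atomValue_subset h Bᶜ
  have h3 : iMeasure h (setVarUnion B) =
      (∑ A : Atom V, if A.support ⊆ Finset.univ then atomValue h A else 0)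
      - ∑ A : Atom V, if A.support ⊆ Bᶜ then atomValue h A else 0 := by
    rw [iMeasure_apply, ← Finset.sum_sub_distrib]
    refine Finset.sum_congr rfl fun A _ => ?_
    have : A ∈ setVarUnion B ↔ ¬ A.support ⊆ Bᶜ := by
      rw [mem_setVarUnion, Finset.not_subset]
      simp [and_comm]
    by_cases hA : A.support ⊆ Bᶜ
    · simp [this, hA]
    · simp [this, hA]
  rw [h3, h1, h2]
  simp

/-- The `I`-Measure agrees with all Shannon's information measures. -/
theorem iMeasure_eq_infoMeasure (h : Finset V → ℝ) (A B C : Finset V) :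
    iMeasure h ((setVarUnion A ∩ setVarUnion B) \ setVarUnion C) = infoMeasure h A B C := by
  classical
  have h1 : infoMeasure h A B C = iMeasure h (setVarUnion (A ∪ C)) +
      iMeasure h (setVarUnion (B ∪ C)) - iMeasure h (setVarUnion (A ∪ B ∪ C)) -
      iMeasure h (setVarUnion C) := by
    simp only [iMeasure_setVarUnion, infoMeasure]
    ring
  rw [h1]
  simp only [iMeasure_apply, ← Finset.sum_add_distrib, ← Finset.sum_sub_distrib]
  refine Finset.sum_congr rfl fun S _ => ?_
  have hU : ∀ D E : Finset V, S ∈ setVarUnion (D ∪ E) ↔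
      S ∈ setVarUnion D ∨ S ∈ setVarUnion E := by
    intro D E
    simp only [mem_setVarUnion, Finset.mem_union, or_and_right, exists_or]
  simp only [hU, Set.mem_sdiff, Set.mem_inter_iff]
  by_cases hA : S ∈ setVarUnion A <;> by_cases hB : S ∈ setVarUnion B <;>
    by_cases hC : S ∈ setVarUnion C <;> simp [hA, hB, hC]

/-- The `I`-Measure is determined by its agreement with Shannon's information measures. -/
theorem eq_iMeasure (h : Finset V → ℝ) (μ : SignedMeasure (Atom V))
    (hμ : ∀ A B C : Finset V,
      μ ((setVarUnion A ∩ setVarUnion B) \ setVarUnion C) = infoMeasure h A B C) :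
    μ = iMeasure h := by
  classical
  have key : ∀ W : Finset V, ∀ A : Atom V, A.support = W → μ {A} = iMeasure h {A} := by
    intro W
    induction W using Finset.strongInduction with
    | _ W ih =>
      rintro A rfl
      -- the part of the field below `A`, as a difference of two unions of set variables
      set E : Set (Atom V) := (setVarUnion Finset.univ ∩ setVarUnion Finset.univ) \
        setVarUnion A.compl with hE
      have hmem : ∀ B : Atom V, B ∈ E ↔ B.support ⊆ A.support := by
        intro B
        obtain ⟨i, hi⟩ := B.2
        have h1 : B ∈ setVarUnion (Finset.univ : Finset V) :=
          (mem_setVarUnion _ _).2 ⟨i, Finset.mem_univ _, hi⟩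
        simp only [hE, Set.mem_sdiff, Set.mem_inter_iff, h1, true_and, and_self,
          mem_setVarUnion, Atom.compl, Finset.mem_compl, not_exists, not_and, Finset.subset_iff]
        exact ⟨fun H i hi => by_contra fun hn => H i hn hi, fun H i hn hi => hn (H hi)⟩
      have hsum : ∀ ν : SignedMeasure (Atom V),
          ν E = ν {A} + ∑ B ∈ Finset.univ.filter (fun B : Atom V => B ∈ E ∧ B ≠ A), ν {B} := by
        intro ν
        have hset : E = ⋃ B ∈ Finset.univ.filter (fun B : Atom V => B ∈ E), {B} := by
          ext B
          simp
        have h2 : ν E = ∑ B ∈ Finset.univ.filter (fun B : Atom V => B ∈ E), ν {B} := by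
          conv_lhs => rw [hset]
          refine VectorMeasure.of_biUnion_finset ?_ ?_
          · intro B _ B' _ hne
            simpa [Function.onFun] using hne
          · intro B _
            exact measurableSet_singleton B
        have hAE : A ∈ Finset.univ.filter (fun B : Atom V => B ∈ E) := by
          simp [hmem]
        rw [h2, ← Finset.add_sum_erase _ _ hAE]
        congr 1
        refine Finset.sum_congr ?_ fun _ _ => rfl
        ext B
        simp [and_comm]
      have h1 := hsum μ
      have h2 := hsum (iMeasure h)
      have h4 : μ E = iMeasure h E := (hμ _ _ _).trans (iMeasure_eq_infoMeasure h _ _ _).symm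
      rw [h4, h2] at h1
      have h3 : ∑ B ∈ Finset.univ.filter (fun B : Atom V => B ∈ E ∧ B ≠ A), μ {B} =
          ∑ B ∈ Finset.univ.filter (fun B : Atom V => B ∈ E ∧ B ≠ A), iMeasure h {B} := by
        refine Finset.sum_congr rfl fun B hB => ?_
        obtain ⟨hBE, hne⟩ := (Finset.mem_filter.1 hB).2
        refine ih B.support (Finset.ssubset_iff_subset_ne.2 ⟨(hmem B).1 hBE, fun h => ?_⟩) B rfl
        exact hne (Subtype.ext h)
      rw [h3] at h1
      linarith
  ext E hE
  have hset : E = ⋃ B ∈ Finset.univ.filter (fun B : Atom V => B ∈ E), {B} := by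
    ext B
    simp
  have h2 : ∀ ν : SignedMeasure (Atom V),
      ν E = ∑ B ∈ Finset.univ.filter (fun B : Atom V => B ∈ E), ν {B} := by
    intro ν
    conv_lhs => rw [hset]
    refine VectorMeasure.of_biUnion_finset ?_ ?_
    · intro B _ B' _ hne
      simpa [Function.onFun] using hne
    · intro B _
      exact measurableSet_singleton B
  rw [h2, h2]
  exact Finset.sum_congr rfl fun B _ => key _ B rfl

open scoped Classical in
/-- The set of the Type I atoms of the graph `G`: the atoms `A` such that the graph `G \ U_A`,
obtained from `G` by removing the vertices in `U_A`, is connected. -/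
noncomputable def typeI (G : SimpleGraph V) : Finset (Atom V) :=
  Finset.univ.filter fun A => (G.induce {i | i ∉ A.compl}).Connected

/-- `U`, `V₁`, `V₂` partition the vertices of `G` (parts may be empty), and no vertex of `V₁` is
connected to a vertex of `V₂` in `G \ U`. -/
def Separates (G : SimpleGraph V) (U V₁ V₂ : Finset V) : Prop :=
  (Disjoint U V₁ ∧ Disjoint U V₂ ∧ Disjoint V₁ V₂ ∧ U ∪ V₁ ∪ V₂ = Finset.univ) ∧
    ∀ a b : {i | i ∉ U}, a.1 ∈ V₁ → b.1 ∈ V₂ → ¬ (G.induce {i | i ∉ U}).Reachable a b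

end SetVariables

section RandomVariables

variable {Ω : Type*} [MeasurableSpace Ω]

/-- The Shannon entropy of the discrete random variable `Y` under `P`, possibly infinite. -/
noncomputable def entropy (P : Measure Ω) {β : Type*} (Y : Ω → β) : ℝ≥0∞ :=
  ∑' y, ENNReal.ofReal (Real.negMulLog (P.real (Y ⁻¹' {y})))

/-- The discrete random variables `Y` and `Z` are independent conditioning on `W`:
`p(y, w, z) p(w) = p(y, w) p(w, z)` for all values. -/
def CondIndepDiscrete (P : Measure Ω) {β γ δ : Type*} (Y : Ω → β) (Z : Ω → γ) (W : Ω → δ) :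
    Prop :=
  ∀ y z w, P.real {ω | Y ω = y ∧ W ω = w ∧ Z ω = z} * P.real {ω | W ω = w} =
    P.real {ω | Y ω = y ∧ W ω = w} * P.real {ω | W ω = w ∧ Z ω = z}

variable {V : Type*} {α : V → Type*}

/-- `X_B`, the tuple of the random variables `X i` with `i ∈ B`. -/
def subTuple (X : ∀ i, Ω → α i) (B : Finset V) (ω : Ω) : ∀ i : B, α i := fun i => X i ω

/-- The function that maps `B` to the joint entropy `H(X_B)`.  It is finite for every `B` when all
the `H(X i)` are finite. -/
noncomputable def entropyFn (P : Measure Ω) (X : ∀ i, Ω → α i) (B : Finset V) : ℝ :=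
  (entropy P (subTuple X B)).toReal

/-- The random variables `X i` form a Markov random field represented by `G` (global Markov
property).  For a path `G` they form a Markov chain. -/
def IsMarkovField [Fintype V] [DecidableEq V] (G : SimpleGraph V) (P : Measure Ω)
    (X : ∀ i, Ω → α i) : Prop :=
  ∀ U V₁ V₂, Separates G U V₁ V₂ →
    CondIndepDiscrete P (subTuple X V₁) (subTuple X V₂) (subTuple X U)

end RandomVariables

section Inequalities

variable {V : Type*} [Fintype V] [DecidableEq V]

/-- The inequality `0 ≤ f h`, where `h B = H(X_B)`, always holds for discrete random variables of
finite entropy that form a Markov random field represented by `G`. -/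
def AlwaysHolds (G : SimpleGraph V) (f : (Finset V → ℝ) → ℝ) : Prop :=
  ∀ (Ω : Type u) [MeasurableSpace Ω] (P : Measure Ω) [IsProbabilityMeasure P]
    (α : V → Type v) [∀ i, Countable (α i)] [∀ i, MeasurableSpace (α i)]
    [∀ i, MeasurableSingletonClass (α i)] (X : ∀ i, Ω → α i),
    (∀ i, Measurable (X i)) → (∀ i, entropy P (X i) ≠ ∞) → IsMarkovField G P X →
      0 ≤ f (entropyFn P X)

/-- The linear information inequality `0 ≤ ∑ B, b B * H(X_B)` is of Shannon type under the Markov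
constraints of `G`: it is implied by the nonnegativity of all Shannon's information measures
together with these constraints, written as the vanishing of conditional mutual informations. -/
def IsShannonType (G : SimpleGraph V) (b : Finset V → ℝ) : Prop :=
  ∀ h : Finset V → ℝ, h ∅ = 0 → (∀ A B C, 0 ≤ infoMeasure h A B C) →
    (∀ U V₁ V₂, Separates G U V₁ V₂ → infoMeasure h V₁ V₂ U = 0) →
      0 ≤ ∑ B, b B * h B

end Inequalities

end MarkovInfo

open MarkovInfo

namespace MarkovInfo

-- Atoms under the Shannon inequalities and the Markov constraints

section Shannon

variable {V : Type*} [DecidableEq V]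

-- The Type I atoms turn out to be coordinates in which the cone cut out by the Shannon inequalities
-- and the Markov constraints is a nonnegative orthant, and every ray of that orthant is attained by
-- a Markov chain.
--
-- For the nonnegativity, let `h` satisfy the Shannon inequalities and the Markov constraints. If `G
-- \ U_A` is disconnected, its pieces are independent given `U_A`, and the alternating sum defining
-- the atom cancels (`atomValue_eq_zero_of_notMem_typeI`). On a path, let `i` and `j` be the least
-- and greatest indices in the support of `A`. The only atom that can carry mass in the region of
-- `I(X_i; X_j | X_{U_A})` is `A` itself, so the atom has this nonnegative value
-- (`atomValue_nonneg_of_pathGraph`). Nothing here needs `h` to be entropic; the analytic part only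
-- shows that entropies of Markov fields satisfy the two hypotheses.
--
-- For the converse, one fair bit repeated on the support of a Type I atom `W` and constant
-- elsewhere is a Markov field, and its `I`-Measure is the point mass `log 2` at `W`
-- (`isMarkovField_repeatedBit`, `iMeasure_repeatedBit`). An inequality that always holds therefore
-- has a nonnegative coefficient at each Type I atom. Combined with the nonnegativity of the atoms
-- for every `h` as above, this gives both parts.

theorem infoMeasure_comm (h : Finset V → ℝ) (A B C : Finset V) :
    infoMeasure h A B C = infoMeasure h B A C := by
  simp only [infoMeasure, Finset.union_comm A B]
  ring

/-- The chain rule for (conditional) mutual information. -/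
theorem infoMeasure_chain (h : Finset V → ℝ) {A A' : Finset V} (hA : A' ⊆ A) (B C : Finset V) :
    infoMeasure h A B C = infoMeasure h A' B C + infoMeasure h A B (A' ∪ C) := by
  have h1 : A ∪ (A' ∪ C) = A ∪ C := by
    rw [← Finset.union_assoc, Finset.union_eq_left.2 hA]
  have h2 : A ∪ B ∪ (A' ∪ C) = A ∪ B ∪ C := by
    rw [← Finset.union_assoc, Finset.union_eq_left.2 (hA.trans Finset.subset_union_left)]
  have h3 : B ∪ (A' ∪ C) = A' ∪ B ∪ C := by
    rw [← Finset.union_assoc, Finset.union_comm B]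
  simp only [infoMeasure, h1, h2, h3]
  ring

/-- Apply the chain rule once in each argument; the terms dropped are themselves information
measures, hence nonnegative. -/
theorem infoMeasure_mono (h : Finset V → ℝ) (hh : ∀ A B C, 0 ≤ infoMeasure h A B C)
    {A A' B B' : Finset V} (hA : A' ⊆ A) (hB : B' ⊆ B) (C : Finset V) :
    infoMeasure h A' B' C ≤ infoMeasure h A B C := by
  have h1 := infoMeasure_chain h hA B C
  have h2 := infoMeasure_chain h hB A' C
  rw [infoMeasure_comm h B, infoMeasure_comm h B'] at h2
  linarith [hh A B (A' ∪ C), hh B A' (B' ∪ C)]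

theorem sum_powerset_neg_one_pow {V : Type*} {W : Finset V} (hW : W.Nonempty) :
    ∑ T ∈ W.powerset, (-1 : ℝ) ^ T.card = 0 := by
  have := Finset.sum_powerset_neg_one_pow_card_of_nonempty hW
  exact_mod_cast this

theorem sum_powerset_disjUnion {W₁ W₂ : Finset V} (hd : Disjoint W₁ W₂) (f : Finset V → ℝ) :
    ∑ T ∈ (W₁ ∪ W₂).powerset, f T = ∑ S ∈ W₁.powerset, ∑ T ∈ W₂.powerset, f (S ∪ T) := by
  rw [← Finset.sum_product']
  symm
  refine Finset.sum_bij' (fun p _ => p.1 ∪ p.2) (fun T _ => (T ∩ W₁, T ∩ W₂)) ?_ ?_ ?_ ?_ ?_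
  · rintro ⟨S, T⟩ h
    simp only [Finset.mem_product, Finset.mem_powerset] at h ⊢
    exact Finset.union_subset_union h.1 h.2
  · intro T _
    simp
  · rintro ⟨S, T⟩ h
    simp only [Finset.mem_product, Finset.mem_powerset] at h
    have h1 := Finset.disjoint_left.1 hd
    ext i
    · have := @h.1 i; have := @h.2 i; have := @h1 i
      simp only [Finset.mem_inter, Finset.mem_union]
      tauto
    · have := @h.1 i; have := @h.2 i; have := @h1 i
      simp only [Finset.mem_inter, Finset.mem_union]
      tauto
  · intro T h
    rw [← Finset.inter_union_distrib_left, Finset.inter_eq_left.2 (Finset.mem_powerset.1 h)]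
  · intro _ _
    rfl

variable [Fintype V]

/-- An atom whose support splits into two nonempty parts that are independent given the
complement of the support has measure zero. -/
theorem atomValue_eq_zero_of_split (h : Finset V → ℝ) (hh : ∀ A B C, 0 ≤ infoMeasure h A B C)
    (A : Atom V) {W₁ W₂ : Finset V} (hW : A.support = W₁ ∪ W₂) (hd : Disjoint W₁ W₂)
    (h₁ : W₁.Nonempty) (h₂ : W₂.Nonempty) (hI : infoMeasure h W₁ W₂ A.compl = 0) :
    atomValue h A = 0 := by
  rw [atomValue, hW, sum_powerset_disjUnion hd]
  -- By monotonicity the independence passes to all subsets `S` and `T`, which makes `h` additive on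
  -- them. Each resulting summand depends on one of `S`, `T` only through its sign, so summing over
  -- that variable gives zero.
  have key : ∀ S ∈ W₁.powerset, ∀ T ∈ W₂.powerset,
      (-1 : ℝ) ^ ((S ∪ T).card + 1) * h (S ∪ T ∪ A.compl) =
        -((-1) ^ S.card * h (S ∪ A.compl)) * (-1) ^ T.card
        + (-1) ^ S.card * -((-1) ^ T.card * (h (T ∪ A.compl) - h A.compl)) := by
    intro S hS T hT
    rw [Finset.mem_powerset] at hS hT
    have h3 : infoMeasure h S T A.compl = 0 :=
      le_antisymm (hI ▸ infoMeasure_mono h hh hS hT _) (hh _ _ _)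
    rw [Finset.card_union_of_disjoint (Finset.disjoint_of_subset_left hS
      (Finset.disjoint_of_subset_right hT hd))]
    have h4 : h (S ∪ T ∪ A.compl) = h (S ∪ A.compl) + h (T ∪ A.compl) - h A.compl := by
      rw [infoMeasure] at h3
      linarith
    rw [h4, pow_succ, pow_add]
    ring
  rw [Finset.sum_congr rfl fun S hS => Finset.sum_congr rfl (key S hS)]
  simp only [Finset.sum_add_distrib, ← Finset.mul_sum, ← Finset.sum_mul,
    sum_powerset_neg_one_pow h₁, sum_powerset_neg_one_pow h₂]
  simp

theorem mem_typeI (G : SimpleGraph V) (A : Atom V) :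
    A ∈ typeI G ↔ (G.induce {i | i ∉ A.compl}).Connected := by
  simp [typeI]

theorem Atom.mem_compl (A : Atom V) (i : V) : i ∈ A.compl ↔ i ∉ A.support := by
  simp [Atom.compl]

/-- The measure vanishes on the atoms that are not of Type I. -/
theorem atomValue_eq_zero_of_notMem_typeI (G : SimpleGraph V) (h : Finset V → ℝ)
    (hh : ∀ A B C, 0 ≤ infoMeasure h A B C)
    (hM : ∀ U V₁ V₂, Separates G U V₁ V₂ → infoMeasure h V₁ V₂ U = 0)
    (A : Atom V) (hA : A ∉ typeI G) : atomValue h A = 0 := by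
  classical
  rw [mem_typeI, SimpleGraph.connected_iff, not_and'] at hA
  obtain ⟨i, hi⟩ := A.2
  have hi' : i ∉ A.compl := fun hc => (A.mem_compl i).1 hc hi
  have hne := hA ⟨⟨i, hi'⟩⟩
  simp only [SimpleGraph.Preconnected, not_forall] at hne
  obtain ⟨a, b, hab⟩ := hne
  -- The component of `a` in `G \ U_A`. Since `b` lies outside it, it splits the support into two
  -- nonempty separated parts.
  set W₁ : Finset V := Finset.univ.filter fun x =>
    ∃ hx : x ∉ A.compl, (G.induce {i | i ∉ A.compl}).Reachable a ⟨x, hx⟩ with hW₁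
  have hmem : ∀ x, x ∈ W₁ ↔
      ∃ hx : x ∉ A.compl, (G.induce {i | i ∉ A.compl}).Reachable a ⟨x, hx⟩ := by
    simp [hW₁]
  have hsub : W₁ ⊆ A.support := by
    intro x hx
    obtain ⟨hx, -⟩ := (hmem x).1 hx
    simpa [Atom.compl] using hx
  refine atomValue_eq_zero_of_split h hh A (W₁ := W₁) (W₂ := A.support \ W₁)
    (by rw [Finset.union_sdiff_of_subset hsub]) Finset.disjoint_sdiff ?_ ?_ (hM _ _ _ ?_)
  · exact ⟨a, (hmem _).2 ⟨a.2, SimpleGraph.Reachable.refl _⟩⟩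
  · refine ⟨b, Finset.mem_sdiff.2 ⟨by simpa [Atom.compl] using b.2, fun hb => ?_⟩⟩
    exact hab ((hmem _).1 hb).2
  · refine ⟨⟨?_, ?_, Finset.disjoint_sdiff, ?_⟩, ?_⟩
    · rw [Atom.compl]
      exact Finset.disjoint_of_subset_right hsub disjoint_compl_left
    · rw [Atom.compl]
      exact Finset.disjoint_of_subset_right Finset.sdiff_subset disjoint_compl_left
    · rw [Finset.union_assoc, Finset.union_sdiff_of_subset hsub, Atom.compl, Finset.union_comm,
        Finset.union_compl]
    · intro x y hx hy hxy
      obtain ⟨_, hx⟩ := (hmem _).1 hx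
      exact (Finset.mem_sdiff.1 hy).2 ((hmem _).2 ⟨y.2, hx.trans hxy⟩)

theorem iMeasure_toSet (h : Finset V → ℝ) (A : Atom V) : iMeasure h A.toSet = atomValue h A := by
  classical
  rw [iMeasure_apply, Atom.toSet_eq]
  simp

/-- Connected vertex sets of a path contain every vertex between two of their members. -/
theorem mem_of_reachable_pathGraph {n : ℕ} {s : Set (Fin n)} {a b : s}
    (hab : ((SimpleGraph.pathGraph n).induce s).Reachable a b) {k : Fin n}
    (h₁ : a.1 ≤ k) (h₂ : k ≤ b.1) : k ∈ s := by
  by_contra hk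
  obtain ⟨w⟩ := hab
  induction w with
  | nil => exact hk (le_antisymm h₁ h₂ ▸ Subtype.property _)
  | @cons a c b hadj _ ih =>
    refine ih ?_ h₂
    -- Each step of the walk changes the index by one, so a walk that starts below `k` and avoids
    -- `k` cannot jump over it.
    have hne : a.1 ≠ k := fun h => hk (h ▸ a.2)
    have h3 : a.1 < k := lt_of_le_of_ne h₁ hne
    rw [SimpleGraph.comap_adj, SimpleGraph.pathGraph_adj] at hadj
    simp only [Function.Embedding.subtype_apply] at hadj
    rw [Fin.le_def]
    rw [Fin.lt_def] at h3
    omega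

/-- The measure is nonnegative on the atoms of a path: on an atom of Type I it is a conditional
mutual information. -/
theorem atomValue_nonneg_of_pathGraph {n : ℕ} (h : Finset (Fin n) → ℝ)
    (hh : ∀ A B C, 0 ≤ infoMeasure h A B C)
    (hM : ∀ U V₁ V₂, Separates (SimpleGraph.pathGraph n) U V₁ V₂ → infoMeasure h V₁ V₂ U = 0)
    (A : Atom (Fin n)) : 0 ≤ atomValue h A := by
  classical
  set i := A.support.min' A.2
  set j := A.support.max' A.2
  have hi : i ∈ A.support := Finset.min'_mem _ _
  have hj : j ∈ A.support := Finset.max'_mem _ _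
  have hI := iMeasure_eq_infoMeasure h {i} {j} A.compl
  -- The region consists of the atoms whose support contains `i` and `j` and lies inside that of
  -- `A`. Such an atom of Type I contains everything between `i` and `j`, hence equals `A`; the
  -- others have measure zero.
  have hval : iMeasure h ((setVarUnion {i} ∩ setVarUnion {j}) \ setVarUnion A.compl) =
      atomValue h A := by
    rw [iMeasure_apply, Finset.sum_eq_single A]
    · rw [if_pos]
      simp [mem_setVarUnion, hi, hj, Atom.compl]
    · intro B _ hBA
      split_ifs with hB
      · simp only [Set.mem_sdiff, Set.mem_inter_iff, mem_setVarUnion, Finset.mem_singleton,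
          exists_eq_left, Atom.mem_compl, not_exists, not_and, not_imp_not] at hB
        obtain ⟨⟨hiB, hjB⟩, hBsub⟩ := hB
        refine atomValue_eq_zero_of_notMem_typeI _ h hh hM B fun hBI => hBA ?_
        rw [mem_typeI] at hBI
        refine Subtype.ext (Finset.Subset.antisymm
          (fun x hx => hBsub x hx) fun k hk => ?_)
        have := mem_of_reachable_pathGraph (hBI.preconnected
          ⟨i, by simpa [Atom.compl] using hiB⟩ ⟨j, by simpa [Atom.compl] using hjB⟩)
          (Finset.min'_le _ k hk) (Finset.le_max' _ k hk)
        exact not_not.1 fun hn => this ((B.mem_compl k).2 hn)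
      · rfl
    · simp
  rw [← hval, hI]
  exact hh _ _ _

end Shannon
-- Entropies of discrete random variables satisfy the two hypotheses
section Entropy

theorem mem_subTuple_fiber {Ω V : Type*} {α : V → Type*} (X : ∀ i, Ω → α i) (B : Finset V) (ω ω' : Ω) :
    ω' ∈ subTuple X B ⁻¹' {subTuple X B ω} ↔ ∀ i ∈ B, X i ω' = X i ω := by
  simp [subTuple, funext_iff]

theorem subTuple_fiber_union {Ω V : Type*} {α : V → Type*} [DecidableEq V] (X : ∀ i, Ω → α i) (A B : Finset V) (ω : Ω) :
    subTuple X (A ∪ B) ⁻¹' {subTuple X (A ∪ B) ω} =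
      subTuple X A ⁻¹' {subTuple X A ω} ∩ subTuple X B ⁻¹' {subTuple X B ω} := by
  ext ω'
  simp only [Set.mem_inter_iff, mem_subTuple_fiber, Finset.mem_union, or_imp, forall_and]

variable {Ω : Type*} [MeasurableSpace Ω] {P : Measure Ω}

section Countable

variable {β γ δ : Type*} [Countable β] [MeasurableSpace β] [MeasurableSingletonClass β]
  [Countable γ] [MeasurableSpace γ] [MeasurableSingletonClass γ]
  [Countable δ] [MeasurableSpace δ] [MeasurableSingletonClass δ]

theorem lintegral_comp_of_countable (P : Measure Ω) {Y : Ω → β} (hY : Measurable Y)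
    (f : β → ℝ≥0∞) : ∫⁻ ω, f (Y ω) ∂P = ∑' y, f y * P (Y ⁻¹' {y}) := by
  rw [← lintegral_map (measurable_of_countable f) hY, lintegral_countable']
  exact tsum_congr fun y => by rw [Measure.map_apply hY (measurableSet_singleton y)]

/-- Marginalisation: integrate the constant 1 against the restriction of `P` to `S`. -/
theorem tsum_measure_fiber_inter (P : Measure Ω) {Y : Ω → β} (hY : Measurable Y) (S : Set Ω) :
    ∑' y, P (Y ⁻¹' {y} ∩ S) = P S := by
  have h := lintegral_comp_of_countable (P.restrict S) hY fun _ => 1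
  rw [lintegral_one, Measure.restrict_apply_univ] at h
  rw [h]
  exact tsum_congr fun y => by
    rw [one_mul, Measure.restrict_apply (hY (measurableSet_singleton y))]

/-- Entropy is the expected self-information. -/
theorem entropy_eq_lintegral (P : Measure Ω) [IsFiniteMeasure P] {Y : Ω → β}
    (hY : Measurable Y) :
    entropy P Y = ∫⁻ ω, ENNReal.ofReal (-Real.log (P.real (Y ⁻¹' {Y ω}))) ∂P := by
  rw [lintegral_comp_of_countable P hY fun y =>
    ENNReal.ofReal (-Real.log (P.real (Y ⁻¹' {y}))), entropy]
  refine tsum_congr fun y => ?_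
  rw [Real.negMulLog, neg_mul, ← mul_neg, ENNReal.ofReal_mul measureReal_nonneg,
    ofReal_measureReal, mul_comm]

/-- The values of probability zero are countably many, so their fibres together form a null set.
This justifies the logarithms and quotients used below. -/
theorem ae_measure_fiber_ne_zero {β : Type*} [Countable β] (P : Measure Ω) (Y : Ω → β) :
    ∀ᵐ ω ∂P, P (Y ⁻¹' {Y ω}) ≠ 0 := by
  have h := (measure_preimage_eq_zero_iff_of_countable (μ := P) (f := Y)
    (Set.to_countable {y | P (Y ⁻¹' {y}) = 0})).2 fun x hx => hx
  rw [ae_iff]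
  simpa using h

/-- The expected likelihood ratio of the conditionally independent law against the joint law is at
most one. -/
theorem lintegral_ratio_le_one (P : Measure Ω) [IsProbabilityMeasure P] {Y : Ω → β} {Z : Ω → γ}
    {W : Ω → δ} (hY : Measurable Y) (hZ : Measurable Z) (hW : Measurable W) :
    ∫⁻ ω, P (Y ⁻¹' {Y ω} ∩ W ⁻¹' {W ω}) * P (Z ⁻¹' {Z ω} ∩ W ⁻¹' {W ω}) /
      (P (Y ⁻¹' {Y ω} ∩ Z ⁻¹' {Z ω} ∩ W ⁻¹' {W ω}) * P (W ⁻¹' {W ω})) ∂P ≤ 1 := by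
  have h := lintegral_comp_of_countable P (hW.prodMk (hY.prodMk hZ)) fun t =>
    P (Y ⁻¹' {t.2.1} ∩ W ⁻¹' {t.1}) * P (Z ⁻¹' {t.2.2} ∩ W ⁻¹' {t.1}) /
      (P (Y ⁻¹' {t.2.1} ∩ Z ⁻¹' {t.2.2} ∩ W ⁻¹' {t.1}) * P (W ⁻¹' {t.1}))
  refine h.trans_le ?_
  -- Here `a` is the joint probability. Values with `a = 0` contribute nothing on the left but
  -- possibly something on the right, so only an inequality is available.
  have hbound : ∀ a b c : ℝ≥0∞, a ≠ ∞ → b / (a * c) * a ≤ b / c := by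
    intro a b c ha
    rcases eq_or_ne a 0 with rfl | h0
    · simp
    · rw [div_eq_mul_inv, ENNReal.mul_inv (Or.inl h0) (Or.inl ha), div_eq_mul_inv]
      refine le_of_eq ?_
      calc b * (a⁻¹ * c⁻¹) * a = b * c⁻¹ * (a⁻¹ * a) := by ring
        _ = b * c⁻¹ := by rw [ENNReal.inv_mul_cancel h0 ha, mul_one]
  calc _ ≤ ∑' t : δ × β × γ, P (Y ⁻¹' {t.2.1} ∩ W ⁻¹' {t.1}) *
        P (Z ⁻¹' {t.2.2} ∩ W ⁻¹' {t.1}) / P (W ⁻¹' {t.1}) := by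
        refine ENNReal.tsum_le_tsum fun t => ?_
        have : (fun ω => (W ω, Y ω, Z ω)) ⁻¹' {t} =
            Y ⁻¹' {t.2.1} ∩ Z ⁻¹' {t.2.2} ∩ W ⁻¹' {t.1} := by
          ext ω
          simp only [Set.mem_preimage, Set.mem_singleton_iff, Prod.ext_iff, Set.mem_inter_iff]
          tauto
        rw [this]
        exact hbound _ _ _ (measure_ne_top _ _)
    _ = ∑' w : δ, P (W ⁻¹' {w}) * P (W ⁻¹' {w}) / P (W ⁻¹' {w}) := by
        rw [ENNReal.tsum_prod']
        refine tsum_congr fun w => ?_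
        rw [ENNReal.tsum_prod']
        simp only [div_eq_mul_inv, ENNReal.tsum_mul_right, ENNReal.tsum_mul_left,
          tsum_measure_fiber_inter P hY, tsum_measure_fiber_inter P hZ]
    _ ≤ ∑' w : δ, P (W ⁻¹' {w} ∩ Set.univ) := by
        refine ENNReal.tsum_le_tsum fun w => ?_
        rw [Set.inter_univ]
        exact ENNReal.div_le_of_le_mul le_rfl
    _ = 1 := by rw [tsum_measure_fiber_inter P hW, measure_univ]

end Countable

variable {V : Type*} {α : V → Type*}

/-- The probability of the value that the tuple `X_B` takes. -/
noncomputable def tupleProb (P : Measure Ω) (X : ∀ i, Ω → α i) (B : Finset V) (ω : Ω) : ℝ :=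
  P.real (subTuple X B ⁻¹' {subTuple X B ω})

theorem tupleProb_nonneg (X : ∀ i, Ω → α i) (B : Finset V) (ω : Ω) : 0 ≤ tupleProb P X B ω :=
  measureReal_nonneg

theorem measurable_subTuple [∀ i, MeasurableSpace (α i)] {X : ∀ i, Ω → α i} (hX : ∀ i, Measurable (X i)) (B : Finset V) :
    Measurable (subTuple X B) :=
  measurable_pi_lambda _ fun i => hX i

theorem measurable_tupleProb [∀ i, Countable (α i)] [∀ i, MeasurableSpace (α i)]
    [∀ i, MeasurableSingletonClass (α i)] {X : ∀ i, Ω → α i} (hX : ∀ i, Measurable (X i)) (B : Finset V) :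
    Measurable (tupleProb P X B) :=
  (measurable_of_countable fun y => P.real (subTuple X B ⁻¹' {y})).comp (measurable_subTuple hX B)

variable [IsProbabilityMeasure P]

theorem neg_log_tupleProb_nonneg (X : ∀ i, Ω → α i) (B : Finset V) (ω : Ω) :
    0 ≤ -Real.log (tupleProb P X B ω) :=
  neg_nonneg.2 (Real.log_nonpos (tupleProb_nonneg X B ω) measureReal_le_one)

theorem ae_tupleProb_pos [∀ i, Countable (α i)] (X : ∀ i, Ω → α i) (B : Finset V) :
    ∀ᵐ ω ∂P, 0 < tupleProb P X B ω := by
  filter_upwards [ae_measure_fiber_ne_zero P (subTuple X B)] with ω hω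
  exact ENNReal.toReal_pos hω (measure_ne_top _ _)

variable [∀ i, Countable (α i)] [∀ i, MeasurableSpace (α i)] [∀ i, MeasurableSingletonClass (α i)]
  {X : ∀ i, Ω → α i}

theorem entropy_subTuple (hX : ∀ i, Measurable (X i)) (B : Finset V) :
    entropy P (subTuple X B) = ∫⁻ ω, ENNReal.ofReal (-Real.log (tupleProb P X B ω)) ∂P :=
  entropy_eq_lintegral P (measurable_subTuple hX B)

theorem entropyFn_eq_integral (hX : ∀ i, Measurable (X i)) (B : Finset V) :
    entropyFn P X B = ∫ ω, -Real.log (tupleProb P X B ω) ∂P := by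
  rw [entropyFn, entropy_subTuple hX, integral_eq_lintegral_of_nonneg_ae
    (Filter.Eventually.of_forall (neg_log_tupleProb_nonneg X B))
    (measurable_tupleProb hX B).log.neg.aestronglyMeasurable]

variable [DecidableEq V]

/-- The expected likelihood ratio, in terms of the probabilities of the tuples. -/
theorem lintegral_tupleProb_ratio_le_one (hX : ∀ i, Measurable (X i)) (A B C : Finset V) :
    ∫⁻ ω, ENNReal.ofReal (tupleProb P X (A ∪ C) ω * tupleProb P X (B ∪ C) ω /
      (tupleProb P X (A ∪ B ∪ C) ω * tupleProb P X C ω)) ∂P ≤ 1 := by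
  refine le_trans (le_of_eq (lintegral_congr_ae ?_)) (lintegral_ratio_le_one P
    (measurable_subTuple hX A) (measurable_subTuple hX B) (measurable_subTuple hX C))
  filter_upwards [ae_tupleProb_pos (P := P) X (A ∪ B ∪ C), ae_tupleProb_pos (P := P) X C]
    with ω h1 h2
  rw [ENNReal.ofReal_div_of_pos (mul_pos h1 h2), ENNReal.ofReal_mul (tupleProb_nonneg _ _ _),
    ENNReal.ofReal_mul (tupleProb_nonneg _ _ _)]
  simp only [tupleProb, subTuple_fiber_union]
  repeat rw [ofReal_measureReal]

/-- Induction through the crude subadditivity `H(X_a, X_B) ≤ H(X_a) + H(X_B) + 1`. It is proved with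
extended nonnegative integrals, because integrability of the logarithms is not yet known. -/
theorem entropy_subTuple_ne_top (hX : ∀ i, Measurable (X i)) (hfin : ∀ i, entropy P (X i) ≠ ∞)
    (B : Finset V) : entropy P (subTuple X B) ≠ ∞ := by
  induction B using Finset.induction_on with
  | empty =>
    have h : ∀ y, subTuple X ∅ ⁻¹' {y} = Set.univ := fun y =>
      Set.eq_univ_of_forall fun ω => Subsingleton.elim _ _
    simp [entropy, h]
  | insert a B _ ih =>
    -- This is `log r ≤ r - 1` for the likelihood ratio `r`, with the `-1` discarded. The unions
    -- with `∅` put the last term in the form of the ratio bound with `C = ∅`.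
    have h1 : ∀ᵐ ω ∂P, ENNReal.ofReal (-Real.log (tupleProb P X (insert a B) ω)) ≤
        ENNReal.ofReal (-Real.log (P.real (X a ⁻¹' {X a ω})))
        + ENNReal.ofReal (-Real.log (tupleProb P X B ω))
        + ENNReal.ofReal (tupleProb P X ({a} ∪ ∅) ω * tupleProb P X (B ∪ ∅) ω /
            (tupleProb P X ({a} ∪ B ∪ ∅) ω * tupleProb P X ∅ ω)) := by
      filter_upwards [ae_tupleProb_pos (P := P) X (insert a B),
        ae_tupleProb_pos (P := P) X B, ae_tupleProb_pos (P := P) X {a}] with ω h1 h2 h3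
      have h4 : tupleProb P X ∅ ω = 1 := by
        rw [tupleProb, Set.eq_univ_of_forall (s := subTuple X ∅ ⁻¹' {subTuple X ∅ ω})
          fun ω => Subsingleton.elim _ _, probReal_univ]
      have h5 : P.real (X a ⁻¹' {X a ω}) = tupleProb P X {a} ω := by
        rw [tupleProb]
        congr 1
        ext ω'
        rw [mem_subTuple_fiber]
        simp
      rw [h5, h4, mul_one, Finset.union_empty, Finset.union_empty, Finset.union_empty,
        ← Finset.insert_eq, ← ENNReal.ofReal_add (neg_log_tupleProb_nonneg _ _ _)
        (neg_log_tupleProb_nonneg _ _ _), ← ENNReal.ofReal_add (add_nonneg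
        (neg_log_tupleProb_nonneg _ _ _) (neg_log_tupleProb_nonneg _ _ _)) (by positivity)]
      refine ENNReal.ofReal_le_ofReal ?_
      have h6 := Real.log_le_sub_one_of_pos (div_pos (mul_pos h3 h2) h1)
      rw [Real.log_div (mul_pos h3 h2).ne' h1.ne', Real.log_mul h3.ne' h2.ne'] at h6
      linarith
    rw [entropy_subTuple hX]
    refine ne_top_of_le_ne_top ?_ (lintegral_mono_ae h1)
    rw [lintegral_add_right, lintegral_add_right, ← entropy_eq_lintegral P (hX a),
      ← entropy_subTuple hX]
    · exact ENNReal.add_ne_top.2 ⟨ENNReal.add_ne_top.2 ⟨hfin a, ih⟩, ne_top_of_le_ne_top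
        ENNReal.one_ne_top (lintegral_tupleProb_ratio_le_one hX _ _ _)⟩
    · exact (measurable_tupleProb hX _).log.neg.ennreal_ofReal
    · exact (((measurable_tupleProb hX _).mul (measurable_tupleProb hX _)).div
        ((measurable_tupleProb hX _).mul (measurable_tupleProb hX _))).ennreal_ofReal

theorem integrable_neg_log_tupleProb (hX : ∀ i, Measurable (X i))
    (hfin : ∀ i, entropy P (X i) ≠ ∞) (B : Finset V) :
    Integrable (fun ω => -Real.log (tupleProb P X B ω)) P := by
  refine (lintegral_ofReal_ne_top_iff_integrable
    (measurable_tupleProb hX B).log.neg.aestronglyMeasurable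
    (Filter.Eventually.of_forall (neg_log_tupleProb_nonneg X B))).1 ?_
  exact (entropy_subTuple hX B).symm.trans_ne (entropy_subTuple_ne_top hX hfin B)

/-- Shannon's information measures are expectations. -/
theorem infoMeasure_entropyFn (hX : ∀ i, Measurable (X i)) (hfin : ∀ i, entropy P (X i) ≠ ∞)
    (A B C : Finset V) :
    infoMeasure (entropyFn P X) A B C = ∫ ω, (-Real.log (tupleProb P X (A ∪ C) ω) +
      -Real.log (tupleProb P X (B ∪ C) ω) - -Real.log (tupleProb P X (A ∪ B ∪ C) ω) -
      -Real.log (tupleProb P X C ω)) ∂P := by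
  have hi := integrable_neg_log_tupleProb hX hfin
  have h1 : Integrable (fun ω => -Real.log (tupleProb P X (A ∪ C) ω) +
      -Real.log (tupleProb P X (B ∪ C) ω)) P := (hi _).add (hi _)
  have h2 : Integrable (fun ω => -Real.log (tupleProb P X (A ∪ C) ω) +
      -Real.log (tupleProb P X (B ∪ C) ω) - -Real.log (tupleProb P X (A ∪ B ∪ C) ω)) P :=
    h1.sub (hi _)
  rw [integral_sub h2 (hi _), integral_sub h1 (hi _), integral_add (hi _) (hi _)]
  simp only [infoMeasure, entropyFn_eq_integral hX]

/-- Gibbs' inequality: the integrand is `-log r ≥ 1 - r` almost everywhere, and the likelihood ratio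
`r` has expectation at most one. -/
theorem infoMeasure_entropyFn_nonneg (hX : ∀ i, Measurable (X i))
    (hfin : ∀ i, entropy P (X i) ≠ ∞) (A B C : Finset V) :
    0 ≤ infoMeasure (entropyFn P X) A B C := by
  have hi := integrable_neg_log_tupleProb hX hfin
  set r : Ω → ℝ := fun ω => tupleProb P X (A ∪ C) ω * tupleProb P X (B ∪ C) ω /
      (tupleProb P X (A ∪ B ∪ C) ω * tupleProb P X C ω) with hr
  have hr0 : ∀ ω, 0 ≤ r ω := fun ω => div_nonneg
    (mul_nonneg (tupleProb_nonneg _ _ _) (tupleProb_nonneg _ _ _))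
    (mul_nonneg (tupleProb_nonneg _ _ _) (tupleProb_nonneg _ _ _))
  have hrm : AEStronglyMeasurable r P := (((measurable_tupleProb hX _).mul
    (measurable_tupleProb hX _)).div ((measurable_tupleProb hX _).mul
    (measurable_tupleProb hX _))).aestronglyMeasurable
  have hr1 : ∫⁻ ω, ENNReal.ofReal (r ω) ∂P ≤ 1 := lintegral_tupleProb_ratio_le_one hX A B C
  have hri : Integrable r P := (lintegral_ofReal_ne_top_iff_integrable hrm
    (Filter.Eventually.of_forall hr0)).1 (ne_top_of_le_ne_top ENNReal.one_ne_top hr1)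
  have hr2 : ∫ ω, r ω ∂P ≤ 1 := by
    rw [integral_eq_lintegral_of_nonneg_ae (Filter.Eventually.of_forall hr0) hrm]
    exact ENNReal.toReal_le_of_le_ofReal zero_le_one (by simpa using hr1)
  rw [infoMeasure_entropyFn hX hfin]
  calc 0 ≤ ∫ ω, (1 - r ω) ∂P := by
        rw [integral_sub (integrable_const _) hri]
        simpa using hr2
    _ ≤ _ := by
        refine integral_mono_ae ((integrable_const _).sub hri)
          ((((hi _).add (hi _)).sub (hi _)).sub (hi _)) ?_
        filter_upwards [ae_tupleProb_pos (P := P) X (A ∪ C), ae_tupleProb_pos (P := P) X (B ∪ C),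
          ae_tupleProb_pos (P := P) X (A ∪ B ∪ C), ae_tupleProb_pos (P := P) X C]
          with ω h1 h2 h3 h4
        have h5 := Real.log_le_sub_one_of_pos (div_pos (mul_pos h1 h2) (mul_pos h3 h4))
        rw [Real.log_div (mul_pos h1 h2).ne' (mul_pos h3 h4).ne', Real.log_mul h1.ne' h2.ne',
          Real.log_mul h3.ne' h4.ne'] at h5
        simp only [hr]
        linarith

/-- Evaluating the product identity at the values actually taken at `ω` and taking logarithms makes
the integrand vanish almost everywhere. -/
theorem infoMeasure_entropyFn_eq_zero (hX : ∀ i, Measurable (X i))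
    (hfin : ∀ i, entropy P (X i) ≠ ∞) {A B C : Finset V}
    (h : CondIndepDiscrete P (subTuple X A) (subTuple X B) (subTuple X C)) :
    infoMeasure (entropyFn P X) A B C = 0 := by
  rw [infoMeasure_entropyFn hX hfin]
  refine integral_eq_zero_of_ae ?_
  filter_upwards [ae_tupleProb_pos (P := P) X (A ∪ C), ae_tupleProb_pos (P := P) X (B ∪ C),
    ae_tupleProb_pos (P := P) X (A ∪ B ∪ C), ae_tupleProb_pos (P := P) X C]
    with ω h1 h2 h3 h4
  have h5 : tupleProb P X (A ∪ B ∪ C) ω * tupleProb P X C ω =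
      tupleProb P X (A ∪ C) ω * tupleProb P X (B ∪ C) ω := by
    have h6 := h (subTuple X A ω) (subTuple X B ω) (subTuple X C ω)
    have e1 : tupleProb P X (A ∪ B ∪ C) ω = P.real {ω' | subTuple X A ω' = subTuple X A ω ∧
        subTuple X C ω' = subTuple X C ω ∧ subTuple X B ω' = subTuple X B ω} := by
      rw [tupleProb, subTuple_fiber_union, subTuple_fiber_union, Set.inter_assoc,
        Set.inter_comm (subTuple X B ⁻¹' _)]
      rfl
    have e2 : tupleProb P X (B ∪ C) ω = P.real {ω' | subTuple X C ω' = subTuple X C ω ∧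
        subTuple X B ω' = subTuple X B ω} := by
      rw [tupleProb, subTuple_fiber_union, Set.inter_comm]
      rfl
    rw [e1, e2, tupleProb, tupleProb, subTuple_fiber_union]
    exact h6
  have h6 := congrArg Real.log h5
  rw [Real.log_mul h1.ne' h2.ne', Real.log_mul h3.ne' h4.ne'] at h6
  simp only [Pi.zero_apply]
  linarith

end Entropy
-- The repeated fair bit as an extremal example
section Example

theorem condIndepDiscrete_symm {Ω : Type*} [MeasurableSpace Ω] {P : Measure Ω} {β γ δ : Type*}
    {Y : Ω → β} {Z : Ω → γ} {W : Ω → δ} (h : CondIndepDiscrete P Y Z W) :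
    CondIndepDiscrete P Z Y W := by
  intro z y w
  have h1 := h y z w
  have e1 : {ω | Z ω = z ∧ W ω = w ∧ Y ω = y} = {ω | Y ω = y ∧ W ω = w ∧ Z ω = z} := by
    ext ω
    simp only [Set.mem_ofPred_eq]
    tauto
  rw [e1, h1, mul_comm]
  simp only [and_comm]

/-- A random variable that is a function of `W` is independent of any other given `W`. -/
theorem condIndepDiscrete_of_factors {Ω : Type*} [MeasurableSpace Ω] (P : Measure Ω)
    {β γ δ : Type*} {Y : Ω → β} (Z : Ω → γ) {W : Ω → δ}
    (h : ∀ ω ω', W ω = W ω' → Y ω = Y ω') : CondIndepDiscrete P Y Z W := by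
  intro y z w
  by_cases hy : ∃ ω, W ω = w ∧ Y ω = y
  · obtain ⟨ω₀, rfl, rfl⟩ := hy
    have e1 : {ω | Y ω = Y ω₀ ∧ W ω = W ω₀ ∧ Z ω = z} = {ω | W ω = W ω₀ ∧ Z ω = z} :=
      Set.ext fun ω => and_iff_right_of_imp fun hω => h _ _ hω.1
    have e2 : {ω | Y ω = Y ω₀ ∧ W ω = W ω₀} = {ω | W ω = W ω₀} :=
      Set.ext fun ω => and_iff_right_of_imp fun hω => h _ _ hω
    rw [e1, e2, mul_comm]
  · have e1 : {ω | Y ω = y ∧ W ω = w ∧ Z ω = z} = ∅ :=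
      Set.eq_empty_of_forall_notMem fun ω hω => hy ⟨ω, hω.2.1, hω.1⟩
    have e2 : {ω | Y ω = y ∧ W ω = w} = ∅ :=
      Set.eq_empty_of_forall_notMem fun ω hω => hy ⟨ω, hω.2, hω.1⟩
    simp [e1, e2]

/-- The law of a fair bit. -/
noncomputable def fairBit : Measure (ULift.{u} Bool) :=
  (2⁻¹ : ℝ≥0∞) • (Measure.dirac ⟨true⟩ + Measure.dirac ⟨false⟩)

instance : IsProbabilityMeasure fairBit.{u} :=
  ⟨by
    simp only [fairBit, Measure.smul_apply, Measure.add_apply, measure_univ, smul_eq_mul]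
    rw [one_add_one_eq_two]
    exact ENNReal.inv_mul_cancel two_ne_zero ENNReal.ofNat_ne_top⟩

instance : MeasurableSingletonClass (ULift.{u} Bool) where
  measurableSet_singleton x := by
    have : ({x} : Set (ULift.{u} Bool)) = ULift.down ⁻¹' {x.down} :=
      Set.ext fun y => ULift.ext_iff
    rw [this]
    exact measurable_down (measurableSet_singleton _)

theorem fairBit_real_singleton (ω : ULift.{u} Bool) : fairBit.real {ω} = 2⁻¹ := by
  rcases ω with ⟨_ | _⟩ <;> simp [fairBit, Measure.real]

variable {V : Type*} [DecidableEq V]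

/-- The random variables that repeat one fair bit on the support of `W` and are constant
elsewhere. -/
def repeatedBit (W : Atom V) (i : V) (ω : ULift.{u} Bool) : ULift.{v} Bool :=
  ⟨decide (i ∈ W.support) && ω.down⟩

theorem measurable_repeatedBit (W : Atom V) (i : V) : Measurable (repeatedBit.{u, v} W i) :=
  measurable_of_countable _

theorem entropy_ne_top_of_finite {Ω : Type*} [MeasurableSpace Ω] (P : Measure Ω) {β : Type*}
    [Finite β] (Y : Ω → β) : entropy P Y ≠ ∞ := by
  have := Fintype.ofFinite β
  rw [entropy, tsum_fintype]
  exact ENNReal.sum_ne_top.2 fun _ _ => ENNReal.ofReal_ne_top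

/-- A tuple reveals the bit if its index set meets the support of `W`, and is constant otherwise.
Both the entropies and the Markov property follow from this dichotomy. -/
theorem subTuple_repeatedBit_eq_iff (W : Atom V) (B : Finset V) (ω ω' : ULift.{u} Bool) :
    subTuple (repeatedBit.{u, v} W) B ω = subTuple (repeatedBit.{u, v} W) B ω' ↔
      (W ∈ setVarUnion B → ω = ω') := by
  rw [mem_setVarUnion]
  simp only [subTuple, funext_iff, Subtype.forall, repeatedBit, ULift.ext_iff]
  constructor
  · rintro h ⟨i, hiB, hiW⟩
    simpa [hiW] using h i hiB
  · intro h i hi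
    by_cases hiW : i ∈ W.support
    · rw [h ⟨i, hi, hiW⟩]
    · simp [hiW]

open scoped Classical in
theorem entropyFn_repeatedBit (W : Atom V) :
    entropyFn fairBit (repeatedBit.{u, v} W) =
      fun B => if W ∈ setVarUnion B then Real.log 2 else 0 := by
  funext B
  rw [entropyFn_eq_integral (measurable_repeatedBit W)]
  split_ifs with hB
  · have : ∀ ω, tupleProb fairBit (repeatedBit.{u, v} W) B ω = 2⁻¹ := by
      intro ω
      rw [tupleProb, ← fairBit_real_singleton ω]
      congr 1
      ext ω'
      simp only [Set.mem_preimage, Set.mem_singleton_iff, subTuple_repeatedBit_eq_iff, hB,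
        true_imp_iff]
    simp [this, Real.log_inv]
  · have : ∀ ω, tupleProb fairBit (repeatedBit.{u, v} W) B ω = 1 := by
      intro ω
      rw [tupleProb, ← probReal_univ (μ := fairBit)]
      congr 1
      ext ω'
      simp [subTuple_repeatedBit_eq_iff, hB]
    simp [this]

variable [Fintype V]

/-- If `U` meets the support of `W`, then `X_U` determines everything. Otherwise the support is a
connected set avoiding `U`, so it cannot meet both `V₁` and `V₂`, and one of the two tuples is
constant. -/
theorem isMarkovField_repeatedBit {G : SimpleGraph V} {W : Atom V} (hW : W ∈ typeI G) :
    IsMarkovField G fairBit (repeatedBit.{u, v} W) := by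
  rintro U V₁ V₂ ⟨-, hsep⟩
  rw [mem_typeI] at hW
  by_cases hU : W ∈ setVarUnion U
  · exact condIndepDiscrete_of_factors _ _ fun ω ω' h =>
      (subTuple_repeatedBit_eq_iff _ _ _ _).2 fun _ =>
        (subTuple_repeatedBit_eq_iff _ _ _ _).1 h hU
  by_cases h₁ : W ∈ setVarUnion V₁
  · refine condIndepDiscrete_symm (condIndepDiscrete_of_factors _ _ fun ω ω' h =>
      (subTuple_repeatedBit_eq_iff _ _ _ _).2 fun h₂ => ?_)
    obtain ⟨a, ha, haW⟩ := (mem_setVarUnion _ _).1 h₁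
    obtain ⟨b, hb, hbW⟩ := (mem_setVarUnion _ _).1 h₂
    have hsub : {i | i ∉ W.compl} ≤ {i | i ∉ U} := by
      intro i hi hiU
      exact hU ((mem_setVarUnion _ _).2 ⟨i, hiU, not_not.1 fun hn => hi ((W.mem_compl i).2 hn)⟩)
    have haC : a ∉ W.compl := fun hn => (W.mem_compl a).1 hn haW
    have hbC : b ∉ W.compl := fun hn => (W.mem_compl b).1 hn hbW
    exact (hsep ⟨a, hsub haC⟩ ⟨b, hsub hbC⟩ ha hb ((hW.preconnected ⟨a, haC⟩ ⟨b, hbC⟩).map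
      (SimpleGraph.induceHomOfLE G hsub).toHom)).elim
  · exact condIndepDiscrete_of_factors _ _ fun ω ω' h =>
      (subTuple_repeatedBit_eq_iff _ _ _ _).2 fun hn => (h₁ hn).elim

open scoped Classical in
-- The lifted copies of `Bool` let the test example live in the universes over which `AlwaysHolds`
-- quantifies.
theorem AlwaysHolds.apply_repeatedBit {G : SimpleGraph V} {f : (Finset V → ℝ) → ℝ}
    (hf : AlwaysHolds.{u, v} G f) {W : Atom V} (hW : W ∈ typeI G) :
    0 ≤ f fun B => if W ∈ setVarUnion B then Real.log 2 else 0 := by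
  rw [← entropyFn_repeatedBit.{u, v} W]
  exact hf _ fairBit _ (repeatedBit W) (measurable_repeatedBit W)
    (fun i => entropy_ne_top_of_finite _ _) (isMarkovField_repeatedBit hW)

open scoped Classical in
/-- The `I`-Measure of the repeated bit is concentrated on one atom. -/
theorem iMeasure_repeatedBit (W : Atom V) :
    iMeasure (fun B => if W ∈ setVarUnion B then Real.log 2 else 0) =
      VectorMeasure.dirac W (Real.log 2) := by
  -- By uniqueness it suffices that the point mass has the right information measures.
  refine (eq_iMeasure _ _ fun A B C => ?_).symm
  have hU : ∀ D E : Finset V, W ∈ setVarUnion (D ∪ E) ↔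
      W ∈ setVarUnion D ∨ W ∈ setVarUnion E := by
    intro D E
    simp only [mem_setVarUnion, Finset.mem_union, or_and_right, exists_or]
  have hmeas := (Set.toFinite ((setVarUnion A ∩ setVarUnion B) \ setVarUnion C)).measurableSet
  have hd : VectorMeasure.dirac W (Real.log 2)
      ((setVarUnion A ∩ setVarUnion B) \ setVarUnion C) =
      if W ∈ (setVarUnion A ∩ setVarUnion B) \ setVarUnion C then Real.log 2 else 0 := by
    split_ifs with h
    · exact VectorMeasure.dirac_apply_of_mem hmeas h
    · exact VectorMeasure.dirac_apply_of_notMem h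
  rw [hd]
  simp only [infoMeasure, hU, Set.mem_sdiff, Set.mem_inter_iff]
  by_cases hA : W ∈ setVarUnion A <;> by_cases hB : W ∈ setVarUnion B <;>
    by_cases hC : W ∈ setVarUnion C <;> simp [hA, hB, hC]

open scoped Classical in
theorem iMeasure_repeatedBit_toSet (W A : Atom V) :
    iMeasure (fun B => if W ∈ setVarUnion B then Real.log 2 else 0) A.toSet =
      if A = W then Real.log 2 else 0 := by
  rw [iMeasure_repeatedBit, Atom.toSet_eq]
  split_ifs with h
  · exact VectorMeasure.dirac_apply_of_mem (measurableSet_singleton A) (by simp [h])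
  · exact VectorMeasure.dirac_apply_of_notMem (by simpa using fun h' => h h'.symm)

open scoped Classical in
/-- A linear combination of joint entropies in terms of the values on the atoms. -/
theorem sum_mul_eq_sum_atomValue (b h : Finset V → ℝ) (h0 : h ∅ = 0) :
    ∑ B, b B * h B =
      ∑ A : Atom V, atomValue h A * ∑ B, b B * if A ∈ setVarUnion B then 1 else 0 := by
  have h1 : ∀ B, h B = ∑ A : Atom V, if A ∈ setVarUnion B then atomValue h A else 0 := by
    intro B
    rw [← iMeasure_apply, iMeasure_setVarUnion, h0, sub_zero]
  rw [Finset.sum_congr rfl fun B _ => by rw [h1 B]]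
  simp only [Finset.mul_sum]
  rw [Finset.sum_comm]
  refine Finset.sum_congr rfl fun A _ => Finset.sum_congr rfl fun B _ => ?_
  split_ifs <;> ring

end Example
end MarkovInfo

-- The main theorem

open MarkovInfo
theorem mainTheorem6 (n : ℕ) :
    (∀ c : Atom (Fin n) → ℝ,
      AlwaysHolds.{u, v} (SimpleGraph.pathGraph n)
          (fun h => ∑ A ∈ typeI (SimpleGraph.pathGraph n), c A * iMeasure h A.toSet) ↔
        ∀ A ∈ typeI (SimpleGraph.pathGraph n), 0 ≤ c A) ∧
    (∀ b : Finset (Fin n) → ℝ,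
      AlwaysHolds.{u, v} (SimpleGraph.pathGraph n) (fun h => ∑ B, b B * h B) →
        IsShannonType (SimpleGraph.pathGraph n) b) := by
  classical
  have hlog : 0 < Real.log 2 := Real.log_pos one_lt_two
  refine ⟨fun c => ⟨fun hc W hW => ?_, fun hc => ?_⟩, fun b hb h h0 hh hM => ?_⟩
  · have h1 := hc.apply_repeatedBit hW
    simp only [iMeasure_repeatedBit_toSet, mul_ite, mul_zero, Finset.sum_ite_eq', hW,
      if_true] at h1
    exact nonneg_of_mul_nonneg_left h1 hlog
  · intro Ω _ P _ α _ _ _ X hX hfin hM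
    refine Finset.sum_nonneg fun A hA => mul_nonneg (hc A hA) ?_
    rw [iMeasure_toSet]
    exact atomValue_nonneg_of_pathGraph _ (infoMeasure_entropyFn_nonneg hX hfin)
      (fun U V₁ V₂ hs => infoMeasure_entropyFn_eq_zero hX hfin (hM U V₁ V₂ hs)) A
  · rw [sum_mul_eq_sum_atomValue b h h0]
    refine Finset.sum_nonneg fun A _ => ?_
    by_cases hA : A ∈ typeI (SimpleGraph.pathGraph n)
    · refine mul_nonneg (atomValue_nonneg_of_pathGraph h hh hM A) ?_
      have h1 := hb.apply_repeatedBit hA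
      -- The coefficient of the atom `A`, times `log 2`, is the given inequality evaluated at the
      -- bit repeated on the support of `A`.
      refine nonneg_of_mul_nonneg_left (b := Real.log 2) (h1.trans_eq ?_) hlog
      rw [Finset.sum_mul]
      refine Finset.sum_congr rfl fun B _ => ?_
      by_cases hB : A ∈ setVarUnion B <;> simp [hB]
    · rw [atomValue_eq_zero_of_notMem_typeI _ h hh hM A hA, zero_mul]
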